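/- Let $A$ be a UHF algebra, i.e. a unital $C^*$-algebra which is the norm closure of the union of an increasing sequence $B_1\subseteq B_2\subseteq\cdots$ of $*$-subalgebras with $1_A\in B_n$ and $B_n\cong M_{k_n}(\mathbb{C})$ for some $k_n\ge 1$. Write $A_+^1$ for the set of positive elements of norm at most $1$, $A^1$ for the closed unit ball, $T(A)$ for the set of tracial states, $A^\infty=\ell^\infty(\mathbb{N},A)/c_0(A)$, and $A_\infty=A^\infty\cap A'$ for the commutant in $A^\infty$ of the constant sequences; $(x_n)_n\in A^\infty$ denotes the class of a bounded sequence. Then $A$ has property (SI): whenever $e_n,f_n\in A_+^1$ $(n\in\mathbb{N})$ satisfy $(e_n)_n,(f_n)_n\in A_\infty$, \[ \lim_{n\to\infty}\max_{\tau\in T(A)}\tau(e_n)=0 \quad\text{and}\quad \liminf_{n\to\infty}\min_{\tau\in T(A)}\tau(f_n^n)>0, \] there exist $s_n\in A^1$ $(n\in\mathbb{N})$ such that \[ (s_n)_n\in A_\infty,\qquad (s_n^*s_n)_n=(e_n)_n\quad\text{and}\quad (f_ns_n)_n=(s_n)_n\quad\text{in }A^\infty . \] -/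

import Mathlib

open Filter Topology
open scoped ComplexOrder BoundedContinuousFunction ENNReal

namespace PropertySI

universe u

/-- The tracial state space `T(A)`: positive linear functionals `τ` with `τ 1 = 1` and
`τ (a b) = τ (b a)`. -/
def tracialStates (A : Type u) [CStarAlgebra A] [PartialOrder A] [StarOrderedRing A] :
    Set (A →ₚ[ℂ] ℂ) :=
  {τ | τ 1 = 1 ∧ ∀ a b : A, τ (a * b) = τ (b * a)}

/-- The algebra `ℓ^∞(ℕ, A)` of bounded sequences in `A`, with pointwise operations and sup norm
(continuity is no condition, because `ℕ` is discrete). -/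
abbrev BoundedSeq (A : Type u) [CStarAlgebra A] : Type u := ℕ →ᵇ A

/-- The ideal `c₀(A)` of sequences that converge to zero in norm. -/
def nullSeq (A : Type u) [CStarAlgebra A] : Ideal (BoundedSeq A) where
  carrier := {x | Tendsto (fun n => ‖x n‖) atTop (𝓝 0)}
  zero_mem' := by simp
  add_mem' := by
    intro x y hx hy
    refine squeeze_zero (fun n => norm_nonneg _) (fun n => norm_add_le (x n) (y n)) ?_
    simpa using Tendsto.add hx hy
  smul_mem' := by
    intro c x hx
    have h : Tendsto (fun n => ‖c‖ * ‖x n‖) atTop (𝓝 0) := by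
      simpa using Tendsto.const_mul ‖c‖ hx
    refine squeeze_zero (fun n => norm_nonneg _) (fun n => ?_) h
    exact (norm_mul_le (c n) (x n)).trans
      (mul_le_mul_of_nonneg_right (c.norm_coe_le_norm n) (norm_nonneg _))

instance nullSeq_isTwoSided (A : Type u) [CStarAlgebra A] : (nullSeq A).IsTwoSided where
  mul_mem_of_left := by
    intro x c hx
    have h : Tendsto (fun n => ‖x n‖ * ‖c‖) atTop (𝓝 0) := by
      simpa using Tendsto.mul_const ‖c‖ hx
    refine squeeze_zero (fun n => norm_nonneg _) (fun n => ?_) h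
    exact (norm_mul_le (x n) (c n)).trans
      (mul_le_mul_of_nonneg_left (c.norm_coe_le_norm n) (norm_nonneg _))

/-- The sequence algebra `A^∞ = ℓ^∞(ℕ, A) / c₀(A)`. -/
noncomputable abbrev SeqAlgebra (A : Type u) [CStarAlgebra A] : Type u := BoundedSeq A ⧸ nullSeq A

/-- The class `(x_n)_n` in `A^∞` of a bounded sequence. -/
noncomputable abbrev seqClass {A : Type u} [CStarAlgebra A] (x : BoundedSeq A) : SeqAlgebra A :=
  Ideal.Quotient.mk (nullSeq A) x

/-- The central sequence algebra `A_∞ = A^∞ ∩ A'`: the commutant in `A^∞` of the copy of `A`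
given by the constant sequences. -/
noncomputable def centralSeqAlgebra (A : Type u) [CStarAlgebra A] : Subring (SeqAlgebra A) :=
  Subring.centralizer (Set.range fun a : A => seqClass (BoundedContinuousFunction.const ℕ a))

/-- Property (SI), without reference to projections. The supremum and infimum over `T(A)` are
taken in `[0, ∞]`; the values `τ (e n)` and `τ (f n ^ n)` are nonnegative reals. -/
def HasPropertySI (A : Type u) [CStarAlgebra A] [PartialOrder A] [StarOrderedRing A] : Prop :=
  ∀ e f : BoundedSeq A,
    (∀ n, 0 ≤ e n ∧ ‖e n‖ ≤ 1) →
    (∀ n, 0 ≤ f n ∧ ‖f n‖ ≤ 1) →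
    seqClass e ∈ centralSeqAlgebra A →
    seqClass f ∈ centralSeqAlgebra A →
    Tendsto (fun n => ⨆ τ ∈ tracialStates A, ENNReal.ofReal (τ (e n)).re) atTop (𝓝 0) →
    0 < liminf (fun n => ⨅ τ ∈ tracialStates A, ENNReal.ofReal (τ (f n ^ n)).re) atTop →
    ∃ s : BoundedSeq A,
      (∀ n, ‖s n‖ ≤ 1) ∧
      seqClass s ∈ centralSeqAlgebra A ∧
      seqClass (star s * s) = seqClass e ∧
      seqClass (f * s) = seqClass s

/-- `A` is a UHF algebra: it is the norm closure of the union of an increasing sequence of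
star-subalgebras `B n`, all containing the unit of `A`, with `B n` isomorphic to the algebra of
`k n × k n` complex matrices for some `k n ≥ 1`. -/
def IsUHF (A : Type u) [CStarAlgebra A] : Prop :=
  ∃ (k : ℕ → ℕ) (B : ℕ → StarSubalgebra ℂ A),
    Monotone B ∧
    (∀ n, 1 ≤ k n ∧ Nonempty (B n ≃⋆ₐ[ℂ] Matrix (Fin (k n)) (Fin (k n)) ℂ)) ∧
    Dense (⋃ n, (B n : Set A))

end PropertySI

/-! One tracial state `τ` suffices: it inherits both trace hypotheses, and on each `B n` it is the
normalized trace, so there it counts eigenvalues. In a matrix algebra a positive contraction `X` of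
small trace has few eigenvalues above `η`, while `Y` with the trace of `Y ^ K` bounded below has
many eigenvalues at least `1 - η`. Sending the former eigenvectors to the latter, weighted by square
roots of eigenvalues of `X`, yields `S` with `star S * S ≈ X` and `Y * S ≈ S`
(`exists_matrix_comparison`).

Centrality comes from working in a corner. For matrix units `E` of `B q` and `p = E o o`, the
compressions of `e n` and `f n` to `p`, perturbed into the dense union, are compared by some `t` in
the corner. The sum of the `E a o * t * E o a` commutes exactly with `B q`, and asymptotic
centrality of `e` and `f` turns the corner relations into the required ones
(`eventually_exists_commuting_comparison`). Letting `q` tend to infinity slowly with `n` finishes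
the proof. -/

open scoped Matrix.Norms.L2Operator Matrix

namespace PropertySI

/-! ### Spectral comparison and traces in matrix algebras -/

section Matrices

variable {n : Type*} [Fintype n] [DecidableEq n]

/-- Unitary diagonalization of a positive semidefinite matrix. -/
theorem exists_unitary_diagonal {X : Matrix n n ℂ} (hX : X.PosSemidef) :
    ∃ U : Matrix n n ℂ, ∃ l : n → ℝ, star U * U = 1 ∧ U * star U = 1 ∧ (∀ i, 0 ≤ l i) ∧
      X = U * Matrix.diagonal (fun i => (l i : ℂ)) * star U := by
  refine ⟨hX.1.eigenvectorUnitary, hX.1.eigenvalues, by simp, by simp,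
    hX.eigenvalues_nonneg, ?_⟩
  conv_lhs => rw [hX.1.spectral_theorem, Unitary.conjStarAlgAut_apply]
  rfl

/-- The order of the eigenvalues in a diagonalization can be permuted. -/
theorem unitary_diagonal_perm (σ : Equiv.Perm n) {U : Matrix n n ℂ} (l : n → ℝ)
    (h₁ : star U * U = 1) (h₂ : U * star U = 1) :
    ∃ V : Matrix n n ℂ, star V * V = 1 ∧ V * star V = 1 ∧
      U * Matrix.diagonal (fun i => (l i : ℂ)) * star U =
        V * Matrix.diagonal (fun i => (l (σ i) : ℂ)) * star V := by
  have hs : star (U.submatrix id σ) = (star U).submatrix σ id := by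
    simp [Matrix.star_eq_conjTranspose]
  have hd : Matrix.diagonal (fun i => (l (σ i) : ℂ)) =
      (Matrix.diagonal (fun i => (l i : ℂ))).submatrix σ σ := by
    rw [Matrix.submatrix_diagonal_equiv]; rfl
  refine ⟨U.submatrix id σ, ?_, ?_, ?_⟩
  · rw [hs]
    have := Matrix.submatrix_mul_equiv (star U) U σ (Equiv.refl n) σ
    simpa [h₁] using this
  · rw [hs, Matrix.submatrix_mul_equiv, h₂]; simp
  · rw [hs, hd, Matrix.submatrix_mul_equiv, Matrix.submatrix_mul_equiv]; simp

theorem trace_unitary_diagonal {U : Matrix n n ℂ} (l : n → ℝ) (h₁ : star U * U = 1) :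
    (U * Matrix.diagonal (fun i => (l i : ℂ)) * star U).trace.re = ∑ i, l i := by
  rw [Matrix.trace_mul_comm, ← mul_assoc, h₁, one_mul, Matrix.trace_diagonal]
  simp

theorem unitary_diagonal_mul {U V W : Matrix n n ℂ} (v w : n → ℂ) (h : star V * V = 1) :
    (U * Matrix.diagonal v * star V) * (V * Matrix.diagonal w * star W) =
      U * Matrix.diagonal (fun i => v i * w i) * star W := by
  rw [← Matrix.diagonal_mul_diagonal]
  calc _ = U * Matrix.diagonal v * (star V * V) * Matrix.diagonal w * star W := by
        simp only [mul_assoc]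
    _ = _ := by rw [h, mul_one]; simp only [mul_assoc]

theorem unitary_diagonal_pow {U : Matrix n n ℂ} (l : n → ℝ) (h₁ : star U * U = 1)
    (h₂ : U * star U = 1) (K : ℕ) :
    (U * Matrix.diagonal (fun i => (l i : ℂ)) * star U) ^ K =
      U * Matrix.diagonal (fun i => ((l i ^ K : ℝ) : ℂ)) * star U := by
  induction K with
  | zero => simp [h₂]
  | succ K ih => rw [pow_succ, ih, unitary_diagonal_mul _ _ h₁]; simp [pow_succ]

theorem norm_unitary_diagonal_le {U V : Matrix n n ℂ} (hU : star U * U = 1)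
    (hU' : U * star U = 1) (hV : star V * V = 1) (hV' : V * star V = 1) {v : n → ℂ} {c : ℝ}
    (hc : 0 ≤ c) (hv : ∀ i, ‖v i‖ ≤ c) :
    ‖U * Matrix.diagonal v * star V‖ ≤ c := by
  have h1 : U ∈ unitary (Matrix n n ℂ) := ⟨hU, hU'⟩
  have h2 : star V ∈ unitary (Matrix n n ℂ) := ⟨by simpa using hV', by simpa using hV⟩
  rw [CStarRing.norm_mul_mem_unitary _ h2, CStarRing.norm_mem_unitary_mul _ h1,
    Matrix.l2_opNorm_diagonal]
  exact (pi_norm_le_iff_of_nonneg hc).2 hv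

theorem le_norm_unitary_diagonal {U : Matrix n n ℂ} (hU : star U * U = 1)
    (hU' : U * star U = 1) (l : n → ℝ) (i : n) :
    l i ≤ ‖U * Matrix.diagonal (fun i => (l i : ℂ)) * star U‖ := by
  have h1 : U ∈ unitary (Matrix n n ℂ) := ⟨hU, hU'⟩
  have h2 : star U ∈ unitary (Matrix n n ℂ) := ⟨by simpa using hU', by simpa using hU⟩
  rw [CStarRing.norm_mul_mem_unitary _ h2, CStarRing.norm_mem_unitary_mul _ h1,
    Matrix.l2_opNorm_diagonal]
  refine le_trans ?_ (norm_le_pi_norm _ i)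
  simpa using le_abs_self (l i)

/-- A bijection from `I` onto a subset of `J` extends to a permutation. It serves to match large
eigenvalues of `X` with eigenvalues of `Y` near 1. -/
theorem exists_perm_of_card_le (I J : Finset n) (h : I.card ≤ J.card) :
    ∃ σ : Equiv.Perm n, ∀ i ∈ I, σ i ∈ J := by
  obtain ⟨J', hJ', hc⟩ := Finset.exists_subset_card_eq h
  let e : {x // x ∈ I} ≃ {x // x ∈ J'} := Finset.equivOfCardEq hc.symm
  refine ⟨e.extendSubtype, fun i hi => hJ' ?_⟩
  rw [e.extendSubtype_apply_of_mem i hi]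
  exact (e ⟨i, hi⟩).2

/-- Comparison of positive contractions in a matrix algebra: if `X` has small normalized trace and
`Y ^ K` has large normalized trace, then up to `η` the matrix `X` is of the form `star S * S` with
`Y * S = S`. -/
theorem exists_matrix_comparison {X Y : Matrix n n ℂ} (hX : X.PosSemidef) (hY : Y.PosSemidef)
    (hX1 : ‖X‖ ≤ 1) (hY1 : ‖Y‖ ≤ 1) {η γ : ℝ} (h0 : 0 < η) (h1 : η < 1) {K : ℕ}
    (htX : X.trace.re ≤ η * (γ * Fintype.card n))
    (htY : (γ + (1 - η) ^ K) * Fintype.card n ≤ (Y ^ K).trace.re) :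
    ∃ S T T' : Matrix n n ℂ, ‖star S * S - X‖ ≤ η ∧ ‖Y * S - S‖ ≤ η ∧ S = Y * T ∧ S = T' * X ∧
      ‖S‖ ≤ 1 := by
  obtain ⟨U, l, hU, hU', hl, rfl⟩ := exists_unitary_diagonal hX
  obtain ⟨W, m, hW, hW', hm, rfl⟩ := exists_unitary_diagonal hY
  have hl1 : ∀ i, l i ≤ 1 := fun i => (le_norm_unitary_diagonal hU hU' l i).trans hX1
  have hm1 : ∀ i, m i ≤ 1 := fun i => (le_norm_unitary_diagonal hW hW' m i).trans hY1
  rw [trace_unitary_diagonal _ hU] at htX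
  rw [unitary_diagonal_pow _ hW hW', trace_unitary_diagonal _ hW] at htY
  -- Markov's inequality for the eigenvalues of `X`.
  have hI : η * ((Finset.univ.filter fun i => η < l i).card : ℝ) ≤ ∑ i, l i := by
    rw [Finset.card_filter, Nat.cast_sum, Finset.mul_sum]
    refine Finset.sum_le_sum fun i _ => ?_
    split_ifs with h
    · simpa using h.le
    · simpa using hl i
  -- Eigenvalues below `1 - η` contribute at most `(1 - η) ^ K` each, the others at most 1.
  have hJ : ∑ i, m i ^ K ≤
      ((Finset.univ.filter fun i => 1 - η ≤ m i).card : ℝ) + (1 - η) ^ K * Fintype.card n := by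
    have : (1 - η) ^ K * (Fintype.card n : ℝ) = ∑ _i : n, (1 - η) ^ K := by
      simp [mul_comm]
    rw [this, Finset.card_filter, Nat.cast_sum, ← Finset.sum_add_distrib]
    refine Finset.sum_le_sum fun i _ => ?_
    have hp : 0 ≤ (1 - η) ^ K := pow_nonneg (by linarith) _
    split_ifs with h
    · have := pow_le_one₀ (n := K) (hm i) (hm1 i)
      push_cast; linarith
    · have := pow_le_pow_left₀ (hm i) (not_le.1 h).le K
      push_cast; linarith
  have hc : (Finset.univ.filter fun i => η < l i).card ≤
      (Finset.univ.filter fun i => 1 - η ≤ m i).card := by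
    have ha : ((Finset.univ.filter fun i => η < l i).card : ℝ) ≤ γ * Fintype.card n :=
      le_of_mul_le_mul_left (hI.trans htX) h0
    have : ((Finset.univ.filter fun i => η < l i).card : ℝ) ≤
      (Finset.univ.filter fun i => 1 - η ≤ m i).card := by linarith
    exact_mod_cast this
  obtain ⟨σ, hσ⟩ := exists_perm_of_card_le _ _ hc
  simp only [Finset.mem_filter, Finset.mem_univ, true_and] at hσ
  obtain ⟨V, hV, hV', hVW⟩ := unitary_diagonal_perm σ m hW hW'
  rw [hVW]
  -- Truncating at `η` costs at most `η` in `star S * S` and leaves only eigenvectors that `σ` sends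
  -- to eigenvalues of `Y` at least `1 - η`.
  let d : n → ℝ := fun i => if η < l i then √(l i) else 0
  have hd0 : ∀ i, 0 ≤ d i := fun i => by
    simp only [d]; split_ifs
    · positivity
    · exact le_rfl
  have hd1 : ∀ i, d i ≤ 1 := fun i => by
    simp only [d]; split_ifs
    · exact Real.sqrt_le_one.2 (hl1 i)
    · exact zero_le_one
  have hstar : star (V * Matrix.diagonal (fun i => (d i : ℂ)) * star U) =
      U * Matrix.diagonal (fun i => (d i : ℂ)) * star V := by
    simp only [star_mul, star_star, mul_assoc]
    congr 2
    simp [Matrix.star_eq_conjTranspose, Matrix.diagonal_conjTranspose, Pi.star_def]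
  -- The factors `T`, `T'` divide by eigenvalues that are nonzero wherever `d` is. They later force
  -- `S` into the corner containing `X` and `Y`.
  refine ⟨V * Matrix.diagonal (fun i => (d i : ℂ)) * star U,
    V * Matrix.diagonal (fun i => ((d i / m (σ i) : ℝ) : ℂ)) * star U,
    V * Matrix.diagonal (fun i => ((d i / l i : ℝ) : ℂ)) * star U, ?_, ?_, ?_, ?_, ?_⟩
  · rw [hstar, unitary_diagonal_mul _ _ hV, ← sub_mul, ← mul_sub, Matrix.diagonal_sub]
    refine norm_unitary_diagonal_le hU hU' hU hU' h0.le fun i => ?_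
    rw [← Complex.ofReal_mul, ← Complex.ofReal_sub, Complex.norm_real, Real.norm_eq_abs]
    simp only [d]; split_ifs with h
    · rw [Real.mul_self_sqrt (hl i)]; simpa using h0.le
    · rw [zero_mul, zero_sub, abs_neg, abs_of_nonneg (hl i)]; exact not_lt.1 h
  · rw [unitary_diagonal_mul _ _ hV, ← sub_mul, ← mul_sub, Matrix.diagonal_sub]
    refine norm_unitary_diagonal_le hV hV' hU hU' h0.le fun i => ?_
    rw [← Complex.ofReal_mul, ← Complex.ofReal_sub, Complex.norm_real, Real.norm_eq_abs]
    by_cases h : η < l i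
    · have h2 := hσ i h
      have h3 := hm1 (σ i)
      rw [show m (σ i) * d i - d i = -((1 - m (σ i)) * d i) by ring, abs_neg,
        abs_of_nonneg (mul_nonneg (by linarith) (hd0 i))]
      nlinarith [hd0 i, hd1 i]
    · simpa [d, h] using h0.le
  · rw [unitary_diagonal_mul _ _ hV]
    congr 3
    ext i
    by_cases h : η < l i
    · have h2 := hσ i h
      have : m (σ i) ≠ 0 := by linarith
      rw [← Complex.ofReal_mul, mul_div_cancel₀ _ this]
    · simp [d, h]
  · rw [unitary_diagonal_mul _ _ hU]
    congr 3
    ext i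
    by_cases h : η < l i
    · have : l i ≠ 0 := by linarith
      rw [← Complex.ofReal_mul, div_mul_cancel₀ _ this]
    · simp [d, h]
  · refine norm_unitary_diagonal_le hV hV' hU hU' zero_le_one fun i => ?_
    rw [Complex.norm_real, Real.norm_eq_abs, abs_of_nonneg (hd0 i)]
    exact hd1 i

/-- A tracial functional on a matrix algebra is a multiple of the trace. -/
theorem tracial_eq_smul_trace (t : Matrix n n ℂ →ₗ[ℂ] ℂ)
    (ht : ∀ X Y, t (X * Y) = t (Y * X)) (X : Matrix n n ℂ) :
    Fintype.card n * t X = X.trace * t 1 := by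
  -- An off-diagonal unit is a product of two units whose reversed product is 0.
  have hoff : ∀ i j (c : ℂ), i ≠ j → t (Matrix.single i j c) = 0 := by
    intro i j c hij
    have := ht (Matrix.single i i 1) (Matrix.single i j c)
    simpa [hij.symm, Matrix.single_mul_single_of_ne] using this
  have hdiag : ∀ i j (c : ℂ), t (Matrix.single i i c) = c * t (Matrix.single j j 1) := by
    intro i j c
    have := ht (Matrix.single i j c) (Matrix.single j i 1)
    simp only [Matrix.single_mul_single_same, mul_one, one_mul] at this
    rw [this, ← smul_eq_mul, ← map_smul, Matrix.smul_single, smul_eq_mul, mul_one]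
  have hX : ∀ (X : Matrix n n ℂ) j, t X = X.trace * t (Matrix.single j j 1) := by
    intro X j
    conv_lhs => rw [Matrix.matrix_eq_sum_single X]
    simp only [map_sum, Matrix.trace, Matrix.diag_apply, Finset.sum_mul]
    refine Finset.sum_congr rfl fun i _ => ?_
    rw [Finset.sum_eq_single i (fun b _ hb => hoff i b _ hb.symm) (by simp), hdiag i j]
  rcases isEmpty_or_nonempty n with hn | ⟨⟨j⟩⟩
  · simp [Matrix.trace]
  · rw [hX X j, hX 1 j, Matrix.trace_one]; ring

/-- The normalized trace is contractive for the operator norm. -/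
theorem norm_trace_le (X : Matrix n n ℂ) : ‖X.trace‖ ≤ Fintype.card n * ‖X‖ := by
  have hentry : ∀ i, ‖X i i‖ ≤ ‖X‖ := by
    intro i
    have h := Matrix.l2_opNorm_mulVec X (EuclideanSpace.single i 1)
    refine le_trans ?_ (h.trans (by simp))
    refine le_trans (le_of_eq ?_) (PiLp.norm_apply_le _ i)
    simp
  calc ‖X.trace‖ ≤ ∑ i, ‖X i i‖ := norm_sum_le _ _
    _ ≤ ∑ _i : n, ‖X‖ := Finset.sum_le_sum fun i _ => hentry i
    _ = _ := by simp

end Matrices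

/-! ### Existence of a tracial state -/

section Trace

variable {A : Type*} [CStarAlgebra A]

/-- The normalized trace of a matrix subalgebra extends to a contractive functional. -/
theorem exists_extension_normalized_trace {k : ℕ} (hk : 1 ≤ k)
    (ψ : Matrix (Fin k) (Fin k) ℂ →⋆ₐ[ℂ] A) (hψ : Function.Injective ψ) :
    ∃ g : StrongDual ℂ A, ‖g‖ ≤ 1 ∧ ∀ X, g (ψ X) = (k : ℂ)⁻¹ * X.trace := by
  let L : Matrix (Fin k) (Fin k) ℂ →ₗ[ℂ] A := ψ.toAlgHom.toLinearMap
  let q := LinearEquiv.ofInjective L hψ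
  let t : LinearMap.range L →ₗ[ℂ] ℂ :=
    (k : ℂ)⁻¹ • (Matrix.traceLinearMap (Fin k) ℂ ℂ ∘ₗ q.symm.toLinearMap)
  have hk0 : (0 : ℝ) < k := by exact_mod_cast hk
  have ht : ∀ x, ‖t x‖ ≤ 1 * ‖x‖ := by
    intro x
    obtain ⟨X, rfl⟩ := q.surjective x
    have h1 : ‖q X‖ = ‖X‖ := NonUnitalStarAlgHom.norm_map ψ hψ X
    have h2 : t (q X) = (k : ℂ)⁻¹ * X.trace := by simp [t]
    have h3 := norm_trace_le X
    rw [h1, h2, norm_mul, norm_inv, Complex.norm_natCast, one_mul, inv_mul_le_iff₀ hk0]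
    simpa using h3
  obtain ⟨g, hg, hgn⟩ := exists_extension_norm_eq (LinearMap.range L) (t.mkContinuous 1 ht)
  refine ⟨g, hgn.trans_le (LinearMap.mkContinuous_norm_le _ zero_le_one _), fun X => ?_⟩
  have := hg (q X)
  have h2 : t (q X) = (k : ℂ)⁻¹ * X.trace := by simp [t]
  rw [LinearMap.mkContinuous_apply, h2] at this
  exact this

/-- The closure of an increasing union of matrix subalgebras has a tracial state. -/
theorem exists_tracialState [PartialOrder A] [StarOrderedRing A] {k : ℕ → ℕ}
    {B : ℕ → StarSubalgebra ℂ A} (hB : Monotone B) (hk : ∀ n, 1 ≤ k n)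
    (ψ : ∀ n, Matrix (Fin (k n)) (Fin (k n)) ℂ →⋆ₐ[ℂ] A)
    (hψ : ∀ n, Function.Injective (ψ n)) (hr : ∀ n, Set.range (ψ n) = B n)
    (hd : Dense (⋃ n, (B n : Set A))) :
    ∃ τ ∈ tracialStates A, ∀ a, ‖τ a‖ ≤ ‖a‖ := by
  choose g hg1 hg using fun n => exists_extension_normalized_trace (hk n) (ψ n) (hψ n)
  have hpre : ∀ n x, x ∈ B n → ∃ X, ψ n X = x := fun n x hx => by
    have : x ∈ Set.range (ψ n) := by rw [hr]; exact hx
    exact this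
  -- Banach–Alaoglu gives a weak-* limit of the Hahn–Banach extensions `g n`. For `n ≥ m`, `g n` is
  -- a normalized trace on `B m`, so the trace identity and positivity pass to the limit there, then
  -- to `A` by density.
  obtain ⟨T, hT, hlim⟩ := (WeakDual.isCompact_closedBall (𝕜 := ℂ) (E := A) 0 1).ultrafilter_le_nhds'
    ((hyperfilter ℕ).map fun n => StrongDual.toWeakDual (g n)) (by
      rw [Ultrafilter.mem_map]
      refine Filter.univ_mem' fun n => ?_
      simpa using hg1 n)
  have hev : ∀ a, Tendsto (fun n => g n a) (hyperfilter ℕ) (𝓝 (T a)) := fun a =>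
    ((WeakDual.eval_continuous a).tendsto T).comp hlim
  have hlt : ∀ m, ∀ᶠ n in (hyperfilter ℕ : Filter ℕ), m ≤ n := fun m =>
    (Nat.hyperfilter_le_atTop) (eventually_ge_atTop m)
  have hTn : ∀ a, ‖T a‖ ≤ ‖a‖ := fun a =>
    le_of_tendsto (hev a).norm (Eventually.of_forall fun n => by
      simpa using (g n).le_of_opNorm_le (hg1 n) a)
  have hTc : Continuous fun a => T a := (WeakDual.toStrongDual T).continuous
  have hT1 : T 1 = 1 := by
    refine tendsto_nhds_unique (hev 1) (tendsto_const_nhds.congr fun n => ?_)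
    have h0 : (k n : ℂ) ≠ 0 := by exact_mod_cast Nat.one_le_iff_ne_zero.1 (hk n)
    have := hg n 1
    rw [map_one, Matrix.trace_one, Fintype.card_fin, inv_mul_cancel₀ h0] at this
    exact this.symm
  have hcomm : ∀ m a b, a ∈ B m → b ∈ B m → T (a * b) = T (b * a) := by
    intro m a b ha hb
    refine tendsto_nhds_unique (hev _) ((hev (b * a)).congr' ?_)
    filter_upwards [hlt m] with n hn
    obtain ⟨X, rfl⟩ := hpre n a (hB hn ha)
    obtain ⟨Y, rfl⟩ := hpre n b (hB hn hb)
    rw [← map_mul, ← map_mul, hg, hg, Matrix.trace_mul_comm]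
  have hcomm1 : ∀ a ∈ ⋃ n, (B n : Set A), ∀ b ∈ ⋃ n, (B n : Set A), T (a * b) = T (b * a) := by
    intro a ha b hb
    obtain ⟨i, hi⟩ := Set.mem_iUnion.1 ha
    obtain ⟨j, hj⟩ := Set.mem_iUnion.1 hb
    exact hcomm (max i j) a b (hB (le_max_left i j) hi) (hB (le_max_right i j) hj)
  have hcomm2 : ∀ a ∈ ⋃ n, (B n : Set A), ∀ b, T (a * b) = T (b * a) := fun a ha b =>
    congrFun (Continuous.ext_on hd (f := fun b => T (a * b)) (g := fun b => T (b * a))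
      (hTc.comp (continuous_const_mul a)) (hTc.comp (continuous_mul_const a)) (hcomm1 a ha)) b
  have hcomm3 : ∀ a b, T (a * b) = T (b * a) := fun a b =>
    congrFun (Continuous.ext_on hd (f := fun a => T (a * b)) (g := fun a => T (b * a))
      (hTc.comp (continuous_mul_const b)) (hTc.comp (continuous_const_mul b))
      (fun a ha => hcomm2 a ha b)) a
  have hpos : ∀ b, 0 ≤ T (star b * b) := by
    have hcl : IsClosed {b : A | 0 ≤ T (star b * b)} :=
      isClosed_Ici.preimage (hTc.comp (continuous_star.mul continuous_id))
    have hsub : (⋃ n, (B n : Set A)) ⊆ {b : A | 0 ≤ T (star b * b)} := by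
      intro b hb
      obtain ⟨m, hm⟩ := Set.mem_iUnion.1 hb
      refine ge_of_tendsto (hev _) ?_
      filter_upwards [hlt m] with n hn
      obtain ⟨X, rfl⟩ := hpre n b (hB hn hm)
      rw [← map_star, ← map_mul, hg]
      refine mul_nonneg (inv_nonneg.2 (by positivity)) ?_
      exact (Matrix.posSemidef_conjTranspose_mul_self X).trace_nonneg
    intro b
    have := hcl.closure_subset_iff.2 hsub
    rw [hd.closure_eq] at this
    exact this (Set.mem_univ b)
  let τ₀ : A →ₗ[ℂ] ℂ := (WeakDual.toStrongDual T).toLinearMap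
  let τ : A →ₚ[ℂ] ℂ :=
    { τ₀ with
      monotone' := by
        intro a b hab
        obtain ⟨c, hc⟩ := CStarAlgebra.nonneg_iff_eq_star_mul_self.1 (sub_nonneg.2 hab)
        have h : 0 ≤ τ₀ (b - a) := by rw [hc]; exact hpos c
        rw [map_sub] at h
        exact sub_nonneg.1 h }
  exact ⟨τ, ⟨hT1, hcomm3⟩, hTn⟩

end Trace

/-! ### Calculus in the sequence algebra -/

section SequenceAlgebra

variable {A : Type*} [CStarAlgebra A]

theorem seqClass_eq_iff {x y : BoundedSeq A} :
    seqClass x = seqClass y ↔ Tendsto (fun n => ‖x n - y n‖) atTop (𝓝 0) :=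
  Ideal.Quotient.eq

theorem seqClass_mul (x y : BoundedSeq A) : seqClass (x * y) = seqClass x * seqClass y :=
  map_mul _ _ _

theorem seqClass_pow (x : BoundedSeq A) (K : ℕ) : seqClass (x ^ K) = seqClass x ^ K :=
  map_pow _ _ _

theorem seqClass_sum {ι : Type*} (s : Finset ι) (x : ι → BoundedSeq A) :
    seqClass (∑ i ∈ s, x i) = ∑ i ∈ s, seqClass (x i) :=
  map_sum _ _ _

/-- The embedding of `A` into its sequence algebra by constant sequences. -/
noncomputable def constClass (A : Type*) [CStarAlgebra A] : A →+* SeqAlgebra A :=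
  (Ideal.Quotient.mk (nullSeq A)).comp
    { toFun := BoundedContinuousFunction.const ℕ
      map_one' := rfl
      map_mul' := fun _ _ => rfl
      map_zero' := rfl
      map_add' := fun _ _ => rfl }

theorem constClass_apply (a : A) :
    constClass A a = seqClass (BoundedContinuousFunction.const ℕ a) := rfl

theorem mem_centralSeqAlgebra_iff {x : SeqAlgebra A} :
    x ∈ centralSeqAlgebra A ↔ ∀ a, constClass A a * x = x * constClass A a := by
  simp [centralSeqAlgebra, Subring.mem_centralizer_iff, constClass_apply]

theorem tendsto_of_seqClass_eq {x y : BoundedSeq A} (h : seqClass x = seqClass y)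
    {τ : A →ₗ[ℂ] ℂ} (hτ : ∀ a, ‖τ a‖ ≤ ‖a‖) :
    Tendsto (fun n => (τ (x n)).re - (τ (y n)).re) atTop (𝓝 0) := by
  refine squeeze_zero_norm (fun n => ?_) (seqClass_eq_iff.1 h)
  rw [← Complex.sub_re, ← map_sub]
  exact (Complex.abs_re_le_norm _).trans (hτ _)

end SequenceAlgebra

/-! ### Matrix units and amplification from a corner -/

section MatrixUnits

variable {A : Type*} [CStarAlgebra A]

/-- A system of matrix units in a `C⋆`-algebra. -/
structure IsMatrixUnits {ι : Type*} [Fintype ι] (E : ι → ι → A) : Prop where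
  mul_same : ∀ a b c, E a b * E b c = E a c
  mul_of_ne : ∀ a b c d, b ≠ c → E a b * E c d = 0
  star_eq : ∀ a b, star (E a b) = E b a
  sum_eq : ∑ a, E a a = 1

theorem isMatrixUnits_map_single {k : ℕ} (ψ : Matrix (Fin k) (Fin k) ℂ →⋆ₐ[ℂ] A) :
    IsMatrixUnits fun a b => ψ (Matrix.single a b 1) where
  mul_same a b c := by rw [← map_mul, Matrix.single_mul_single_same, mul_one]
  mul_of_ne a b c d h := by rw [← map_mul, Matrix.single_mul_single_of_ne _ _ _ _ h, map_zero]
  star_eq a b := by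
    rw [← map_star, Matrix.star_eq_conjTranspose, Matrix.conjTranspose_single, star_one]
  sum_eq := by
    rw [← map_sum, ← map_one ψ]
    congr 1
    rw [← Matrix.diagonal_one, ← Matrix.sum_single_eq_diagonal]

namespace IsMatrixUnits

variable {ι : Type*} [Fintype ι] {E : ι → ι → A} (hE : IsMatrixUnits E) (o : ι)
include hE

/-- Only the summand `c = b` survives. The value agrees with that in `amplify_mul`, so the
amplification commutes with every matrix unit. -/
theorem mul_amplify {t : A} (a b : ι) :
    E a b * ∑ c, E c o * t * E o c = E a o * t * E o b := by
  rw [Finset.mul_sum, Finset.sum_eq_single b]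
  · simp only [← mul_assoc, hE.mul_same]
  · intro c _ hc
    simp only [← mul_assoc, hE.mul_of_ne _ _ _ _ hc.symm, zero_mul]
  · simp

theorem amplify_mul {t : A} (a b : ι) :
    (∑ c, E c o * t * E o c) * E a b = E a o * t * E o b := by
  rw [Finset.sum_mul, Finset.sum_eq_single a]
  · rw [mul_assoc, hE.mul_same]
  · intro c _ hc
    rw [mul_assoc, hE.mul_of_ne _ _ _ _ hc, mul_zero]
  · simp

theorem star_amplify_mul_amplify {t : A} (ht : E o o * t = t) :
    star (∑ c, E c o * t * E o c) * ∑ c, E c o * t * E o c =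
      ∑ c, E c o * (star t * t) * E o c := by
  simp only [star_sum, star_mul, hE.star_eq, Finset.sum_mul]
  refine Finset.sum_congr rfl fun a _ => ?_
  calc E a o * (star t * E o a) * ∑ c, E c o * t * E o c
      = E a o * star t * (E o a * ∑ c, E c o * t * E o c) := by simp only [mul_assoc]
    _ = E a o * star t * (E o o * t) * E o a := by rw [hE.mul_amplify]; simp only [mul_assoc]
    _ = _ := by rw [ht]; simp only [mul_assoc]

/-- Conjugating `star t * t ≤ 1` by `E o c` gives a bound by `E c c`, and these sum to 1. Unlike in
`norm_amplify_le`, no factor depending on the system appears. -/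
theorem norm_amplify_le_one [PartialOrder A] [StarOrderedRing A] {t : A} (ht : E o o * t = t)
    (ht1 : ‖t‖ ≤ 1) : ‖∑ c, E c o * t * E o c‖ ≤ 1 := by
  have h1 : star t * t ≤ 1 := by
    rw [← CStarAlgebra.norm_le_one_iff_of_nonneg _ (star_mul_self_nonneg t),
      CStarRing.norm_star_mul_self]
    exact mul_le_one₀ ht1 (norm_nonneg _) ht1
  have h2 : ∑ c, E c o * (star t * t) * E o c ≤ 1 := by
    rw [← hE.sum_eq]
    refine Finset.sum_le_sum fun c _ => ?_
    have := star_left_conjugate_le_conjugate h1 (E o c)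
    rwa [hE.star_eq, mul_one, hE.mul_same] at this
  rw [← hE.star_amplify_mul_amplify o ht,
    ← CStarAlgebra.norm_le_one_iff_of_nonneg _ (star_mul_self_nonneg _),
    CStarRing.norm_star_mul_self] at h2
  nlinarith [norm_nonneg (∑ c, E c o * t * E o c)]

end IsMatrixUnits

theorem norm_amplify_le {ι : Type*} [Fintype ι] (E : ι → ι → A) (o : ι) (t : A) :
    ‖∑ c, E c o * t * E o c‖ ≤ (∑ c, ‖E c o‖ * ‖E o c‖) * ‖t‖ := by
  rw [Finset.sum_mul]
  refine norm_sum_le_of_le _ fun c _ => ?_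
  calc ‖E c o * t * E o c‖ ≤ ‖E c o‖ * ‖t‖ * ‖E o c‖ :=
        norm_mul₃_le
    _ = _ := by ring

end MatrixUnits

/-! ### Perturbation into the dense union -/

section Approximation

variable {A : Type*} [CStarAlgebra A] [PartialOrder A] [StarOrderedRing A]

/-- Positive contractions are approximated by `star c * c` with contractions `c` from a given dense
union of star subalgebras. -/
theorem exists_star_mul_self_approx {B : ℕ → StarSubalgebra ℂ A}
    (hd : Dense (⋃ n, (B n : Set A))) {e : A} (he : 0 ≤ e) (he1 : ‖e‖ ≤ 1) {ε : ℝ} (hε : 0 < ε) :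
    ∃ c, (∃ n, c ∈ B n) ∧ ‖c‖ ≤ 1 ∧ ‖star c * c - e‖ ≤ ε := by
  obtain ⟨r, rfl⟩ := CStarAlgebra.nonneg_iff_eq_star_mul_self.1 he
  have hr1 : ‖r‖ ≤ 1 := by
    rw [CStarRing.norm_star_mul_self] at he1
    nlinarith [norm_nonneg r]
  obtain ⟨u, hu, hur⟩ := hd.exists_dist_lt r (show 0 < ε / 4 by positivity)
  obtain ⟨n, hn⟩ := Set.mem_iUnion.1 hu
  rw [dist_comm, dist_eq_norm] at hur
  -- Dividing by `t` makes `u` a contraction and moves it by at most `t - 1 ≤ ε / 4`.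
  let t : ℝ := max 1 ‖u‖
  have ht1 : 1 ≤ t := le_max_left _ _
  have ht0 : 0 < t := by linarith
  have htu : t ≤ 1 + ε / 4 := by
    refine max_le (by linarith) ?_
    have := norm_le_norm_add_norm_sub' u r
    linarith
  have hc1 : ‖((t⁻¹ : ℝ) : ℂ) • u‖ ≤ 1 := by
    rw [norm_smul, Complex.norm_real, norm_inv, Real.norm_eq_abs, abs_of_pos ht0,
      inv_mul_le_iff₀ ht0, mul_one]
    exact le_max_right _ _
  have hcu : ‖((t⁻¹ : ℝ) : ℂ) • u - u‖ ≤ ε / 4 := by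
    have h : u = ((t : ℝ) : ℂ) • ((t⁻¹ : ℝ) : ℂ) • u := by
      rw [smul_smul, ← Complex.ofReal_mul, mul_inv_cancel₀ ht0.ne', Complex.ofReal_one, one_smul]
    have h2 : ((t⁻¹ : ℝ) : ℂ) • u - u = ((1 - t : ℝ) : ℂ) • ((t⁻¹ : ℝ) : ℂ) • u := by
      conv_lhs => rw [h]
      rw [Complex.ofReal_sub, sub_smul, Complex.ofReal_one, one_smul]
      simp only [← h]
    rw [h2, norm_smul, Complex.norm_real, Real.norm_eq_abs, abs_sub_comm,
      abs_of_nonneg (by linarith)]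
    nlinarith [norm_nonneg (((t⁻¹ : ℝ) : ℂ) • u)]
  set c := ((t⁻¹ : ℝ) : ℂ) • u with hc
  have hcr : ‖c - r‖ ≤ ε / 2 := by
    have := norm_sub_le_norm_sub_add_norm_sub c u r
    linarith
  refine ⟨c, ⟨n, (B n).smul_mem hn _⟩, hc1, ?_⟩
  have h3 : star c * c - star r * r = star c * (c - r) + star (c - r) * r := by
    rw [star_sub]; noncomm_ring
  calc ‖star c * c - star r * r‖ ≤ ‖star c * (c - r)‖ + ‖star (c - r) * r‖ := by
        rw [h3]; exact norm_add_le _ _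
    _ ≤ ‖c‖ * ‖c - r‖ + ‖c - r‖ * ‖r‖ := by
        refine add_le_add ((norm_mul_le _ _).trans_eq ?_) ((norm_mul_le _ _).trans_eq ?_) <;>
          rw [norm_star]
    _ ≤ ε := by nlinarith [norm_nonneg (c - r)]

/-- A sequence of positive contractions agrees in the sequence algebra with `star c * c` for a
sequence `c` of contractions from a given dense union of star subalgebras. -/
theorem exists_seqClass_star_mul_self {B : ℕ → StarSubalgebra ℂ A}
    (hd : Dense (⋃ n, (B n : Set A))) (e : BoundedSeq A) (he : ∀ n, 0 ≤ e n ∧ ‖e n‖ ≤ 1) :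
    ∃ c : BoundedSeq A, (∀ n, ∃ m, c n ∈ B m) ∧ (∀ n, ‖c n‖ ≤ 1) ∧
      seqClass (star c * c) = seqClass e := by
  choose c hcB hc1 hce using fun n : ℕ =>
    exists_star_mul_self_approx hd (he n).1 (he n).2 (Nat.one_div_pos_of_nat (n := n) (α := ℝ))
  refine ⟨BoundedContinuousFunction.ofNormedAddCommGroupDiscrete c 1 hc1, hcB, hc1, ?_⟩
  exact seqClass_eq_iff.2
    (squeeze_zero (fun _ => norm_nonneg _) hce tendsto_one_div_add_atTop_nhds_zero_nat)

end Approximation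

/-! ### Comparison in a corner -/

section Comparison

variable {A : Type*} [CStarAlgebra A] [PartialOrder A] [StarOrderedRing A]

/-- Comparison of positive elements in the corner `p A p` of a `C⋆`-algebra, for elements that come
from a matrix subalgebra. -/
theorem exists_corner_comparison {k : ℕ} (hk : 1 ≤ k) (ψ : Matrix (Fin k) (Fin k) ℂ →⋆ₐ[ℂ] A)
    (hψ : Function.Injective ψ) {τ : A →ₚ[ℂ] ℂ} (hτ : τ ∈ tracialStates A) {c d p : A}
    (hc : c ∈ Set.range ψ) (hd : d ∈ Set.range ψ) (hp : p ∈ Set.range ψ) (hps : star p = p)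
    (hpp : p * p = p) (hp1 : ‖p‖ ≤ 1) (hc1 : ‖c‖ ≤ 1) (hd1 : ‖d‖ ≤ 1) {η γ : ℝ} (h0 : 0 < η)
    (h1 : η < 1) {K : ℕ} (hte : (τ (p * (star c * c) * p)).re ≤ η * γ)
    (htf : γ + (1 - η) ^ K ≤ (τ ((p * (star d * d) * p) ^ K)).re) :
    ∃ s : A, ‖s‖ ≤ 1 ∧ p * s = s ∧ s * p = s ∧ ‖star s * s - p * (star c * c) * p‖ ≤ η ∧
      ‖p * (star d * d) * p * s - s‖ ≤ η := by
  obtain ⟨C, rfl⟩ := hc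
  obtain ⟨D, rfl⟩ := hd
  obtain ⟨P, rfl⟩ := hp
  have hk0 : (0 : ℝ) < k := by exact_mod_cast hk
  -- Uniqueness of the trace on a matrix algebra.
  have htr : ∀ X, (X.trace).re = k * (τ (ψ X)).re := by
    intro X
    have h := tracial_eq_smul_trace (τ.toLinearMap ∘ₗ ψ.toAlgHom.toLinearMap)
      (fun X Y => by
        show τ (ψ (X * Y)) = τ (ψ (Y * X))
        rw [map_mul ψ, map_mul ψ]; exact hτ.2 _ _) X
    have h1 : (τ.toLinearMap ∘ₗ ψ.toAlgHom.toLinearMap) 1 = 1 := by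
      show τ (ψ 1) = 1
      rw [map_one]; exact hτ.1
    rw [h1, mul_one, Fintype.card_fin] at h
    rw [← h]
    show ((k : ℂ) * τ (ψ X)).re = _
    rw [← Complex.ofReal_natCast, Complex.re_ofReal_mul]
  have hnorm : ∀ X, ‖ψ X‖ = ‖X‖ := NonUnitalStarAlgHom.norm_map ψ hψ
  have hPs : star P = P := hψ (by rw [map_star, hps])
  have hpsd : ∀ X : Matrix (Fin k) (Fin k) ℂ, (P * (star X * X) * P).PosSemidef := by
    intro X
    have := Matrix.posSemidef_conjTranspose_mul_self (X * P)
    rw [← Matrix.star_eq_conjTranspose, star_mul, hPs] at this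
    simpa only [mul_assoc] using this
  have hpsi : ∀ X, ψ (P * (star X * X) * P) = ψ P * (star (ψ X) * ψ X) * ψ P := by
    intro X; simp only [map_mul, map_star]
  have hle : ∀ X, ‖ψ X‖ ≤ 1 → ‖P * (star X * X) * P‖ ≤ 1 := by
    intro X hX
    rw [← hnorm, hpsi]
    refine norm_mul₃_le.trans ?_
    rw [CStarRing.norm_star_mul_self]
    have h2 : ‖ψ X‖ * ‖ψ X‖ ≤ 1 := mul_le_one₀ hX (norm_nonneg _) hX
    exact mul_le_one₀ (mul_le_one₀ hp1 (by positivity) h2) (norm_nonneg _) hp1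
  obtain ⟨S, T, T', hS1, hS2, hST, hST', hS⟩ := exists_matrix_comparison (η := η) (γ := γ) (K := K)
    (hpsd C) (hpsd D) (hle C hc1) (hle D hd1) h0 h1
    (by
      rw [htr, hpsi, Fintype.card_fin]
      nlinarith)
    (by
      rw [htr, map_pow, hpsi, Fintype.card_fin]
      nlinarith)
  refine ⟨ψ S, (hnorm S).trans_le hS, ?_, ?_, ?_, ?_⟩
  · rw [hST, map_mul, hpsi]
    simp only [← mul_assoc, hpp]
  · rw [hST', map_mul, hpsi]
    simp only [mul_assoc, hpp]
  · rw [← hpsi, ← map_star, ← map_mul, ← map_sub, hnorm]; exact hS1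
  · rw [← hpsi, ← map_mul, ← map_sub, hnorm]; exact hS2

theorem re_tracial_compress_le {τ : A →ₚ[ℂ] ℂ} (hτ : τ ∈ tracialStates A) {p q : A}
    (hp : star p = p) (hpp : p * p = p) (hq : q = 1 - p) (c : A) :
    (τ (p * (star c * c) * p)).re ≤ (τ (star c * c)).re := by
  have hqs : star q = q := by rw [hq, star_sub, hp, star_one]
  have hqq : q * q = q := by rw [hq]; noncomm_ring; rw [hpp]; abel
  have h1 : τ (p * (star c * c) * p) = τ (star c * c * p) := by
    rw [mul_assoc, hτ.2 p, mul_assoc, mul_assoc, mul_assoc, hpp]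
  have h2 : τ (q * (star c * c) * q) = τ (star c * c * q) := by
    rw [mul_assoc, hτ.2 q, mul_assoc, mul_assoc, mul_assoc, hqq]
  have h3 : 0 ≤ τ (q * (star c * c) * q) := by
    refine τ.map_nonneg ?_
    have := star_mul_self_nonneg (c * q)
    rwa [star_mul, hqs, show q * star c * (c * q) = q * (star c * c) * q by
      simp only [mul_assoc]] at this
  have h4 : τ (star c * c) = τ (p * (star c * c) * p) + τ (q * (star c * c) * q) := by
    rw [h1, h2, ← map_add, ← mul_add, hq, add_sub_cancel, mul_one]
  rw [h4, Complex.add_re]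
  linarith [(Complex.nonneg_iff.1 h3).1]

/-- If `p` commutes with `z` then `(p z p) ^ K = p z ^ K p`, for a projection `p` and `K ≠ 0`. -/
theorem compress_pow {R : Type*} [Ring R] {p z : R} (hpp : p * p = p) (hz : p * z = z * p) {K : ℕ}
    (hK : K ≠ 0) : (p * z * p) ^ K = p * z ^ K := by
  have h1 : p * z * p = p * z := by rw [mul_assoc, ← hz, ← mul_assoc, hpp]
  have hp : ∀ K : ℕ, K ≠ 0 → p ^ K = p := by
    intro K hK
    exact IsIdempotentElem.pow_eq hpp hK
  rw [h1, (show Commute p z from hz).mul_pow, hp K hK]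

end Comparison

/-! ### Approximate solutions commuting with a matrix algebra -/

section LocalStatement

variable {A : Type*} [CStarAlgebra A] [PartialOrder A] [StarOrderedRing A]

/-- Approximate solutions that commute exactly with a given system of matrix units. -/
theorem eventually_exists_commuting_comparison {k : ℕ → ℕ} {B : ℕ → StarSubalgebra ℂ A}
    (hB : Monotone B) (hk : ∀ n, 1 ≤ k n)
    (ψ : ∀ n, Matrix (Fin (k n)) (Fin (k n)) ℂ →⋆ₐ[ℂ] A)
    (hψ : ∀ n, Function.Injective (ψ n)) (hr : ∀ n, Set.range (ψ n) = B n)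
    (hd : Dense (⋃ n, (B n : Set A))) {τ : A →ₚ[ℂ] ℂ} (hτ : τ ∈ tracialStates A)
    (hτn : ∀ a, ‖τ a‖ ≤ ‖a‖) {e f : BoundedSeq A} (he : ∀ n, 0 ≤ e n ∧ ‖e n‖ ≤ 1)
    (hf : ∀ n, 0 ≤ f n ∧ ‖f n‖ ≤ 1) (hec : seqClass e ∈ centralSeqAlgebra A)
    (hfc : seqClass f ∈ centralSeqAlgebra A)
    (hte : Tendsto (fun n => (τ (e n)).re) atTop (𝓝 0)) {δ : ℝ} (hδ : 0 < δ)
    (htf : ∀ᶠ n in atTop, δ ≤ (τ (f n ^ n)).re) {ι : Type*} [Fintype ι] {E : ι → ι → A}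
    (hE : IsMatrixUnits E) (o : ι) {m : ℕ} (hEB : ∀ a b, E a b ∈ B m) {ε : ℝ} (hε : 0 < ε) :
    ∀ᶠ n in atTop, ∃ s : A, ‖s‖ ≤ 1 ∧ (∀ a b, E a b * s = s * E a b) ∧
      ‖star s * s - e n‖ ≤ ε ∧ ‖f n * s - s‖ ≤ ε := by
  rw [mem_centralSeqAlgebra_iff] at hec hfc
  obtain ⟨c, hcB, hc1, hce⟩ := exists_seqClass_star_mul_self hd e he
  obtain ⟨d, hdB, hd1, hdf⟩ := exists_seqClass_star_mul_self hd f hf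
  let κ : A → BoundedSeq A := BoundedContinuousFunction.const ℕ
  have hκ : ∀ a, seqClass (κ a) = constClass A a := fun _ => rfl
  let p := E o o
  have hps : star p = p := hE.star_eq o o
  have hpp : p * p = p := hE.mul_same o o o
  have hp1 : ‖p‖ ≤ 1 := by
    have h := CStarRing.norm_star_mul_self (x := p)
    rw [hps, hpp] at h
    nlinarith [norm_nonneg p]
  have hPP : constClass A p * constClass A p = constClass A p := by rw [← map_mul, hpp]
  let x : BoundedSeq A := κ p * (star c * c) * κ p
  let y : BoundedSeq A := κ p * (star d * d) * κ p
  have hx : seqClass x = constClass A p * seqClass e * constClass A p := by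
    rw [seqClass_mul, seqClass_mul, hce, hκ]
  have hy : seqClass y = constClass A p * seqClass f * constClass A p := by
    rw [seqClass_mul, seqClass_mul, hdf, hκ]
  -- constants
  let M : ℝ := ∑ a, ‖E a o‖ * ‖E o a‖
  have hM : 0 ≤ M := Finset.sum_nonneg fun _ _ => by positivity
  obtain ⟨η, h0, h1, hη⟩ : ∃ η : ℝ, 0 < η ∧ η < 1 ∧ M * η ≤ ε / 2 := by
    refine ⟨min (1 / 2) (ε / (2 * (M + 1))), by positivity,
      (min_le_left _ _).trans_lt (by norm_num), ?_⟩
    calc M * min (1 / 2) (ε / (2 * (M + 1))) ≤ (M + 1) * (ε / (2 * (M + 1))) := by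
          gcongr
          · linarith
          · exact min_le_right _ _
      _ = ε / 2 := by field_simp
  let N : ℝ := Fintype.card ι
  have hN : 0 < N := by
    have : Nonempty ι := ⟨o⟩
    exact Nat.cast_pos.2 Fintype.card_pos
  -- The trace of `f n ^ K` is at least `4 * N * γ`. Passing to `p * f n ^ K` and then to `y n ^ K`
  -- loses `γ` each time, and the remaining `2 * γ` dominates `γ + (1 - η) ^ K`.
  let γ : ℝ := δ / (4 * N)
  have hγ : 0 < γ := by positivity
  obtain ⟨K, hK0, hK⟩ : ∃ K : ℕ, K ≠ 0 ∧ (1 - η) ^ K ≤ γ := by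
    obtain ⟨K, hK⟩ := exists_pow_lt_of_lt_one hγ (show 1 - η < 1 by linarith)
    -- The exponent must be nonzero for `compress_pow`.
    refine ⟨K + 1, K.succ_ne_zero, le_trans ?_ hK.le⟩
    exact pow_le_pow_of_le_one (by linarith) (by linarith) K.le_succ
  -- the trace of `x`
  have htx : ∀ᶠ n in atTop, (τ (x n)).re ≤ η * γ := by
    have h2 := (tendsto_of_seqClass_eq hce (τ := τ.toLinearMap) hτn).add hte
    rw [add_zero] at h2
    filter_upwards [h2.eventually_le_const (show 0 < η * γ by positivity)] with n hn
    refine (re_tracial_compress_le hτ hps hpp rfl (c n)).trans ?_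
    have h3 : (τ (star (c n) * c n)).re - (τ (e n)).re + (τ (e n)).re ≤ η * γ := hn
    linarith
  -- the trace of `y ^ K`
  have hty : ∀ᶠ n in atTop, γ + (1 - η) ^ K ≤ (τ (y n ^ K)).re := by
    have hpf : ∀ a, constClass A a * seqClass f ^ K = seqClass f ^ K * constClass A a := fun a =>
      (show Commute (constClass A a) (seqClass f) from hfc a).pow_right K
    have e1 : seqClass (y ^ K) = seqClass (κ p * f ^ K) := by
      rw [seqClass_pow, hy, compress_pow hPP (hfc p) hK0, seqClass_mul, seqClass_pow, hκ]
    -- By centrality the summands are `E a a * f ^ K` modulo null sequences. By traciality each has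
    -- the trace of `p * f n ^ K`, whence the factor `N` in `e3`.
    have e2 : seqClass (∑ a, κ (E a o) * f ^ K * κ (E o a)) = seqClass (f ^ K) := by
      simp only [seqClass_sum, seqClass_mul, seqClass_pow, hκ]
      have : ∀ a, constClass A (E a o) * seqClass f ^ K * constClass A (E o a) =
          constClass A (E a a) * seqClass f ^ K := fun a => by
        rw [mul_assoc, ← hpf, ← mul_assoc, ← map_mul, hE.mul_same]
      simp only [this]
      rw [← Finset.sum_mul, ← map_sum, hE.sum_eq, map_one, one_mul]
    have t1 := tendsto_of_seqClass_eq e1 (τ := τ.toLinearMap) hτn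
    have t2 := tendsto_of_seqClass_eq e2 (τ := τ.toLinearMap) hτn
    have e3 : ∀ n, (τ ((∑ a, κ (E a o) * f ^ K * κ (E o a) : BoundedSeq A) n)).re =
        N * (τ (p * f n ^ K)).re := by
      intro n
      have : (∑ a, κ (E a o) * f ^ K * κ (E o a) : BoundedSeq A) n =
          ∑ a, E a o * f n ^ K * E o a := by
        rw [BoundedContinuousFunction.sum_apply]; rfl
      rw [this, map_sum]
      have h : ∀ a, τ (E a o * f n ^ K * E o a) = τ (p * f n ^ K) := fun a => by
        rw [hτ.2, ← mul_assoc, hE.mul_same]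
      simp only [h]
      rw [Finset.sum_const, nsmul_eq_mul, Finset.card_univ, ← Complex.ofReal_natCast,
        Complex.re_ofReal_mul]
    have hb1 : ∀ᶠ n in atTop, -γ ≤ (τ (y n ^ K)).re - (τ (p * f n ^ K)).re :=
      t1.eventually_const_le (by linarith)
    have hb2 : ∀ᶠ n in atTop, (τ ((∑ a, κ (E a o) * f ^ K * κ (E o a) : BoundedSeq A) n)).re -
        (τ (f n ^ K)).re ≥ -(δ / 4) :=
      t2.eventually_const_le (by linarith)
    filter_upwards [hb1, hb2, htf, eventually_ge_atTop K] with n g1 g2 g3 g4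
    rw [e3] at g2
    -- Powers of a positive contraction decrease, so the bound on `f n ^ n` yields one for the fixed
    -- exponent `K`.
    have g5 : (τ (f n ^ n)).re ≤ (τ (f n ^ K)).re := by
      have hf1 : f n ≤ 1 := (CStarAlgebra.norm_le_one_iff_of_nonneg _ (hf n).1).1 (hf n).2
      exact (Complex.le_def.1 (OrderHomClass.mono τ
        (CStarAlgebra.pow_antitone (hf n).1 hf1 g4))).1
    have g6 : 3 * γ ≤ (τ (p * f n ^ K)).re := by
      have : 3 * γ = (3 * δ / 4) / N := by simp only [γ]; field_simp
      rw [this, div_le_iff₀ hN]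
      linarith
    linarith
  -- the error terms
  have hr1 : Tendsto (fun n => ‖(∑ a, κ (E a o) * x * κ (E o a) : BoundedSeq A) n - e n‖) atTop
      (𝓝 0) := by
    refine seqClass_eq_iff.1 ?_
    simp only [seqClass_sum, seqClass_mul, hx, hκ]
    have : ∀ a, constClass A (E a o) * (constClass A p * seqClass e * constClass A p) *
        constClass A (E o a) = constClass A (E a a) * seqClass e := fun a => by
      calc _ = constClass A (E a o * p) * seqClass e * constClass A (p * E o a) := by
            simp only [map_mul, mul_assoc]
        _ = constClass A (E a o) * constClass A (E o a) * seqClass e := by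
            rw [hE.mul_same, hE.mul_same, mul_assoc, ← hec, mul_assoc]
        _ = _ := by rw [← map_mul, hE.mul_same]
    simp only [this]
    rw [← Finset.sum_mul, ← map_sum, hE.sum_eq, map_one, one_mul]
  have hr2 : Tendsto (fun n => ∑ a, ‖f n * E a o - E a o * y n‖ * ‖E o a‖) atTop (𝓝 0) := by
    rw [← Finset.sum_const_zero (s := (Finset.univ : Finset ι))]
    refine tendsto_finsetSum _ fun a _ => ?_
    have : seqClass (f * κ (E a o)) = seqClass (κ (E a o) * y) := by
      rw [seqClass_mul, seqClass_mul, hy, hκ, ← hfc, mul_assoc (constClass A p), ← hfc, ← mul_assoc,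
        ← mul_assoc, ← map_mul, ← map_mul, hE.mul_same, hE.mul_same]
    have h := (seqClass_eq_iff.1 this).mul_const ‖E o a‖
    rw [zero_mul] at h
    exact h
  filter_upwards [htx, hty, hr1.eventually_le_const (show 0 < ε / 2 by positivity),
    hr2.eventually_le_const (show 0 < ε / 2 by positivity)] with n hn1 hn2 hn3 hn4
  obtain ⟨i, hi⟩ := hcB n
  obtain ⟨j, hj⟩ := hdB n
  -- A single matrix algebra contains `c n`, `d n` and all the matrix units; its size may depend on
  -- `n`.
  let q := max m (max i j)
  have hmem : ∀ {a l}, a ∈ B l → l ≤ q → a ∈ Set.range (ψ q) := fun {a l} ha hl => by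
    rw [hr]; exact hB hl ha
  obtain ⟨t, ht1, hpt, htp, ht2, ht3⟩ := exists_corner_comparison (hk q) (ψ q) (hψ q) hτ
    (c := c n) (d := d n) (p := p) (hmem hi (by simp [q])) (hmem hj (by simp [q]))
    (hmem (hEB o o) (by simp [q])) hps hpp hp1 (hc1 n) (hd1 n) h0 h1 hn1 hn2
  change ‖star t * t - x n‖ ≤ η at ht2
  change ‖y n * t - t‖ ≤ η at ht3
  refine ⟨∑ a, E a o * t * E o a, hE.norm_amplify_le_one o hpt ht1, fun a b => by
    rw [hE.mul_amplify, hE.amplify_mul], ?_, ?_⟩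
  · rw [hE.star_amplify_mul_amplify o hpt]
    have hs : (∑ a, κ (E a o) * x * κ (E o a) : BoundedSeq A) n = ∑ a, E a o * x n * E o a := by
      rw [BoundedContinuousFunction.sum_apply]; rfl
    rw [hs] at hn3
    have h2 : ‖∑ a, E a o * (star t * t) * E o a - ∑ a, E a o * x n * E o a‖ ≤ ε / 2 := by
      rw [← Finset.sum_sub_distrib]
      simp only [← sub_mul, ← mul_sub]
      exact ((norm_amplify_le E o _).trans (mul_le_mul_of_nonneg_left ht2 hM)).trans hη
    have := norm_sub_le_norm_sub_add_norm_sub (∑ a, E a o * (star t * t) * E o a)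
      (∑ a, E a o * x n * E o a) (e n)
    linarith
  · have hs : f n * ∑ a, E a o * t * E o a - ∑ a, E a o * t * E o a =
        ∑ a, (f n * E a o - E a o * y n) * t * E o a + ∑ a, E a o * (y n * t - t) * E o a := by
      rw [Finset.mul_sum, ← Finset.sum_sub_distrib, ← Finset.sum_add_distrib]
      refine Finset.sum_congr rfl fun a _ => ?_
      noncomm_ring
    rw [hs]
    have h2 : ‖∑ a, (f n * E a o - E a o * y n) * t * E o a‖ ≤ ε / 2 := by
      refine (norm_sum_le_of_le _ fun a _ => ?_).trans hn4
      refine norm_mul₃_le.trans ?_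
      gcongr
      exact mul_le_of_le_one_right (norm_nonneg _) ht1
    have h3 : ‖∑ a, E a o * (y n * t - t) * E o a‖ ≤ ε / 2 :=
      ((norm_amplify_le E o _).trans (mul_le_mul_of_nonneg_left ht3 hM)).trans hη
    exact (norm_add_le _ _).trans (by linarith)

end LocalStatement

/-! ### Diagonal argument -/

section Diagonal

/-- A diagonal choice: if each of countably many conditions holds eventually, then along a sequence
of indices tending to infinity they hold simultaneously. -/
theorem exists_diagonal_index {P : ℕ → ℕ → Prop} (h : ∀ q, ∀ᶠ n in atTop, P q n) :
    ∃ r : ℕ → ℕ, Tendsto r atTop atTop ∧ ∀ᶠ n in atTop, P (r n) n := by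
  classical
  -- `Nat.findGreatest` returns 0 if no `q ≤ n` works, so `P 0 n` is needed in the second claim.
  refine ⟨fun n => Nat.findGreatest (fun q => P q n) n, tendsto_atTop.2 fun q => ?_, ?_⟩
  · filter_upwards [h q, eventually_ge_atTop q] with n hn hq
    exact Nat.le_findGreatest hq hn
  · filter_upwards [h 0] with n hn
    exact Nat.findGreatest_spec (P := fun q => P q n) (Nat.zero_le n) hn

end Diagonal

end PropertySI

/-! ### Assembly of the central sequence -/

open PropertySI in
theorem mainTheorem9 {A : Type*} [CStarAlgebra A] [PartialOrder A] [StarOrderedRing A]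
    (hA : PropertySI.IsUHF A) : PropertySI.HasPropertySI A := by
  obtain ⟨k, B, hB, hkB, hd⟩ := hA
  have hk : ∀ n, 1 ≤ k n := fun n => (hkB n).1
  let φ := fun n => (hkB n).2.some
  let ψ : ∀ n, Matrix (Fin (k n)) (Fin (k n)) ℂ →⋆ₐ[ℂ] A := fun n =>
    (B n).subtype.comp (φ n).symm.toStarAlgHom
  have hψ : ∀ n, Function.Injective (ψ n) := fun n =>
    Subtype.val_injective.comp (φ n).symm.injective
  have hr : ∀ n, Set.range (ψ n) = B n := by
    intro n
    ext a
    constructor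
    · rintro ⟨X, rfl⟩
      exact ((φ n).symm X).2
    · intro ha
      exact ⟨φ n ⟨a, ha⟩, congrArg Subtype.val ((φ n).symm_apply_apply ⟨a, ha⟩)⟩
  obtain ⟨τ, hτ, hτn⟩ := exists_tracialState hB hk ψ hψ hr hd
  intro e f he hf hec hfc hte htf
  have hte' : Tendsto (fun n => (τ (e n)).re) atTop (𝓝 0) := by
    have h1 : Tendsto (fun n => ENNReal.ofReal (τ (e n)).re) atTop (𝓝 0) :=
      tendsto_of_tendsto_of_tendsto_of_le_of_le tendsto_const_nhds hte (fun _ => zero_le)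
        fun n => le_iSup₂ (f := fun τ (_ : τ ∈ tracialStates A) => ENNReal.ofReal (τ (e n)).re) τ hτ
    have h2 := (ENNReal.tendsto_toReal ENNReal.zero_ne_top).comp h1
    refine h2.congr fun n => ?_
    exact ENNReal.toReal_ofReal (Complex.nonneg_iff.1 (τ.map_nonneg (he n).1)).1
  obtain ⟨δ, hδ, htf'⟩ : ∃ δ : ℝ, 0 < δ ∧ ∀ᶠ n in atTop, δ ≤ (τ (f n ^ n)).re := by
    obtain ⟨c, hc0, hc⟩ := exists_between htf
    have hct : c ≠ ⊤ := (hc.trans_le le_top).ne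
    refine ⟨c.toReal, ENNReal.toReal_pos hc0.ne' hct, ?_⟩
    filter_upwards [eventually_lt_of_lt_liminf hc] with n hn
    have h1 : c ≤ ENNReal.ofReal (τ (f n ^ n)).re := hn.le.trans (iInf₂_le τ hτ)
    have h2 : 0 < (τ (f n ^ n)).re := ENNReal.ofReal_pos.1 (hc0.trans_le h1)
    exact (ENNReal.le_ofReal_iff_toReal_le hct h2.le).1 h1
  have hloc : ∀ q : ℕ, ∀ᶠ n in atTop, ∃ s : A, ‖s‖ ≤ 1 ∧ (∀ b ∈ B q, b * s = s * b) ∧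
      ‖star s * s - e n‖ ≤ 1 / ((q : ℝ) + 1) ∧ ‖f n * s - s‖ ≤ 1 / ((q : ℝ) + 1) := by
    intro q
    have := eventually_exists_commuting_comparison hB hk ψ hψ hr hd hτ hτn he hf hec hfc hte' hδ
      htf' (isMatrixUnits_map_single (ψ q)) ⟨0, hk q⟩ (m := q)
      (fun a b => by
        have : ψ q (Matrix.single a b 1) ∈ Set.range (ψ q) := ⟨_, rfl⟩
        rwa [hr] at this) (Nat.one_div_pos_of_nat (n := q) (α := ℝ))
    filter_upwards [this] with n ⟨s, h1, h2, h3⟩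
    refine ⟨s, h1, fun b hb => ?_, h3⟩
    obtain ⟨X, rfl⟩ : b ∈ Set.range (ψ q) := by rw [hr]; exact hb
    -- The matrix units span `B q`.
    have hX : ψ q X = ∑ i, ∑ j, X i j • ψ q (Matrix.single i j 1) := by
      conv_lhs => rw [Matrix.matrix_eq_sum_single X]
      simp only [map_sum, ← map_smul, Matrix.smul_single, smul_eq_mul, mul_one]
    rw [hX]
    simp only [Finset.sum_mul, Finset.mul_sum, smul_mul_assoc, mul_smul_comm, h2]
  obtain ⟨r, hrt, hrs⟩ := exists_diagonal_index hloc
  have hs' : ∀ n, ∃ s : A, ‖s‖ ≤ 1 ∧ ((∃ s : A, ‖s‖ ≤ 1 ∧ (∀ b ∈ B (r n), b * s = s * b) ∧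
      ‖star s * s - e n‖ ≤ 1 / ((r n : ℝ) + 1) ∧ ‖f n * s - s‖ ≤ 1 / ((r n : ℝ) + 1)) →
      (∀ b ∈ B (r n), b * s = s * b) ∧
      ‖star s * s - e n‖ ≤ 1 / ((r n : ℝ) + 1) ∧ ‖f n * s - s‖ ≤ 1 / ((r n : ℝ) + 1)) := by
    intro n
    by_cases h : ∃ s : A, ‖s‖ ≤ 1 ∧ (∀ b ∈ B (r n), b * s = s * b) ∧
      ‖star s * s - e n‖ ≤ 1 / ((r n : ℝ) + 1) ∧ ‖f n * s - s‖ ≤ 1 / ((r n : ℝ) + 1)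
    · obtain ⟨s, h1, h2⟩ := h
      exact ⟨s, h1, fun _ => h2⟩
    -- A harmless value at the finitely many `n` without a local solution.
    · exact ⟨0, by simp, fun h' => absurd h' h⟩
  choose s hs1 hs using hs'
  replace hs := hrs.mono fun n hn => hs n hn
  have hlim : Tendsto (fun n => 1 / ((r n : ℝ) + 1)) atTop (𝓝 0) :=
    tendsto_one_div_add_atTop_nhds_zero_nat.comp hrt
  refine ⟨BoundedContinuousFunction.ofNormedAddCommGroupDiscrete s 1 hs1, hs1, ?_, ?_, ?_⟩
  · rw [mem_centralSeqAlgebra_iff]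
    intro a
    rw [constClass_apply, ← map_mul, ← map_mul, seqClass_eq_iff]
    show Tendsto (fun n => ‖a * s n - s n * a‖) atTop (𝓝 0)
    rw [Metric.tendsto_atTop']
    intro ε hε
    -- Once `r n ≥ q`, `s n` commutes with `b`, so its commutator with `a` is that with `a - b`.
    obtain ⟨b, hb, hab⟩ := hd.exists_dist_lt a (show 0 < ε / 2 by positivity)
    obtain ⟨q, hq⟩ := Set.mem_iUnion.1 hb
    rw [dist_eq_norm] at hab
    have hev := hs.and (hrt.eventually_ge_atTop q)
    obtain ⟨n₀, hn₀⟩ := eventually_atTop.1 hev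
    refine ⟨n₀, fun n hn => ?_⟩
    obtain ⟨h1, h2⟩ := hn₀ n hn.le
    have h3 : a * s n - s n * a = (a - b) * s n - s n * (a - b) := by
      rw [sub_mul, mul_sub, h1.1 b (hB h2 hq)]; abel
    rw [dist_zero_right, norm_norm, h3]
    have h4 : ‖(a - b) * s n‖ ≤ ‖a - b‖ :=
      (norm_mul_le _ _).trans (mul_le_of_le_one_right (norm_nonneg _) (hs1 n))
    have h5 : ‖s n * (a - b)‖ ≤ ‖a - b‖ :=
      (norm_mul_le _ _).trans (mul_le_of_le_one_left (norm_nonneg _) (hs1 n))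
    have := norm_sub_le ((a - b) * s n) (s n * (a - b))
    linarith
  · exact seqClass_eq_iff.2 (squeeze_zero' (Eventually.of_forall fun _ => norm_nonneg _)
      (hs.mono fun n hn => hn.2.1) hlim)
  · exact seqClass_eq_iff.2 (squeeze_zero' (Eventually.of_forall fun _ => norm_nonneg _)
      (hs.mono fun n hn => hn.2.2) hlim)
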